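/- Consider an exchange economy with $n$ agents and $m$ goods. Each agent $i$ has an endowment $e_i\in\mathbb R^m_+\setminus\{0\}$ (not necessarily interior) and a utility function $u_i:\mathbb R^m_+\to\mathbb R$ that is piecewise-linear concave, i.e. the pointwise minimum on $\mathbb R^m_+$ of finitely many (at least one) affine functions. Let $\bar e=\sum_i e_i$. An allocation $(x_i)_i$, $x_i\in\mathbb R^m_+$, is feasible if $\sum_i x_i\le\bar e$. Assume that preferences are monotonic under limited resources: for every good $k$ and every feasible allocation $(x_i)_i$ with $\sum_i x_i^k<\bar e^k$ there are an agent $j$ and a bundle $\tilde x_j\in\mathbb R^m_+$ such that $u_j(\tilde x_j)>u_j(x_j)$, $\tilde x_j^{k'}=x_j^{k'}$ for all $k'\ne k$, $\tilde x_j^k>x_j^k$, and $\tilde x_j^k+\sum_{i\ne j}x_i^k\le\bar e^k$. Let $U$ be the utility possibility set, i.e. the set of all $v\in\mathbb R^n$ such that for some feasible allocation $(x_i)_i$ one has $\underline u_i\le v_i\le u_i(x_i)$ for all $i$, where $\underline u_i$ is the infimum of $u_i(x_i)$ over all feasible allocations. If $(u_i(e_i))_i$ is Pareto optimal, i.e.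 it belongs to $U$ and there is no $w\in U$ with $w_i\ge u_i(e_i)$ for all $i$ and $w\ne(u_i(e_i))_i$, then there is a price vector $p\in\mathbb R^m$ with $p^k>0$ for all $k$ such that $(p,(e_i)_i)$ is a Walrasian equilibrium, where a pair $(p,(x_i)_i)$ is a Walrasian equilibrium if $\sum_i x_i=\bar e$ and, for each $i$, $x_i$ maximizes $u_i$ over the budget set $\{y\in\mathbb R^m_+ : \langle p,y\rangle\le\langle p,e_i\rangle\}$. -/

import Mathlib

open scoped BigOperators

namespace ExchangeEconomy

/-- The consumption set `ℝ^m_+` of bundles of `m` goods. -/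
def Bundles (m : ℕ) : Set (Fin m → ℝ) := {x | ∀ k, 0 ≤ x k}

/-- `u` is piecewise-linear concave on `X`: there, it is the minimum of a finite nonempty family
of affine functions. The values of `u` outside `X` play no role. -/
def IsPLCOn {m : ℕ} (X : Set (Fin m → ℝ)) (u : (Fin m → ℝ) → ℝ) : Prop :=
  ∃ (K : Finset ((Fin m → ℝ) →ᵃ[ℝ] ℝ)) (hK : K.Nonempty),
    ∀ x ∈ X, u x = K.inf' hK (fun a => a x)

/-- The total endowment `ē = ∑ i, e i`. -/
def total {n m : ℕ} (e : Fin n → Fin m → ℝ) : Fin m → ℝ := ∑ i, e i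

/-- The feasible allocations: profiles `x` of bundles with `∑ i, x i ≤ ē`. -/
def Feasible {n m : ℕ} (e : Fin n → Fin m → ℝ) : Set (Fin n → Fin m → ℝ) :=
  {x | (∀ i, x i ∈ Bundles m) ∧ ∀ k, ∑ i, x i k ≤ total e k}

/-- The feasible allocation `x` does not exhaust the supply of good `k`. -/
def StrictlyFeasibleFor {n m : ℕ} (e : Fin n → Fin m → ℝ) (k : Fin m)
    (x : Fin n → Fin m → ℝ) : Prop :=
  x ∈ Feasible e ∧ ∑ i, x i k < total e k

/-- Preferences are monotonic under limited resources: whenever a feasible allocation does not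
exhaust good `k`, some agent becomes strictly better off by consuming more of good `k` (and the
same amount of every other good) within the total supply of good `k`. -/
def MonotonicUnderLimitedResources {n m : ℕ} (e : Fin n → Fin m → ℝ)
    (u : Fin n → (Fin m → ℝ) → ℝ) : Prop :=
  ∀ (k : Fin m) (x : Fin n → Fin m → ℝ), StrictlyFeasibleFor e k x →
    ∃ (j : Fin n) (y : Fin m → ℝ), y ∈ Bundles m ∧ u j (x j) < u j y ∧
      (∀ k', k' ≠ k → y k' = x j k') ∧ x j k < y k ∧
      y k + ∑ i ∈ Finset.univ.erase j, x i k ≤ total e k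

/-- The utility possibility set of the economy: profiles `v` for which some feasible allocation
`x` satisfies `v i ∈ [inf u_i, u_i (x i)]` for every agent `i`, the infimum being taken over all
feasible allocations. -/
def utilityPossibilitySet {n m : ℕ} (e : Fin n → Fin m → ℝ)
    (u : Fin n → (Fin m → ℝ) → ℝ) : Set (Fin n → ℝ) :=
  {v | ∃ x ∈ Feasible e, ∀ i,
    v i ∈ Set.Icc (sInf ((fun x' : Fin n → Fin m → ℝ => u i (x' i)) '' Feasible e)) (u i (x i))}

/-- `v` is a Pareto optimal (maximal) point of `U`. -/
def ParetoOptimal {n : ℕ} (U : Set (Fin n → ℝ)) (v : Fin n → ℝ) : Prop :=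
  v ∈ U ∧ ¬ ∃ w ∈ U, (∀ i, v i ≤ w i) ∧ w ≠ v

/-- The budget set of an agent with endowment `ei` at the prices `p`. -/
def budgetSet {m : ℕ} (p ei : Fin m → ℝ) : Set (Fin m → ℝ) :=
  {y | y ∈ Bundles m ∧ p ⬝ᵥ y ≤ p ⬝ᵥ ei}

/-- `(p, x)` is a Walrasian equilibrium: markets clear, and every agent's bundle maximizes her
utility over her budget set. -/
def IsWalrasianEquilibrium {n m : ℕ} (e : Fin n → Fin m → ℝ) (u : Fin n → (Fin m → ℝ) → ℝ)
    (p : Fin m → ℝ) (x : Fin n → Fin m → ℝ) : Prop :=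
  ∑ i, x i = total e ∧
    ∀ i, x i ∈ budgetSet p (e i) ∧ ∀ y ∈ budgetSet p (e i), u i y ≤ u i (x i)

end ExchangeEconomy

/-!
The theorem is linear programming duality for piecewise-linear concave utilities.

Write an allocation as `x` and consider the polyhedron of all `(x, t)` with `0 ≤ x`, `∑ i, x i ≤ ē`,
`0 ≤ t` and `u i (e i) + t i ≤ a (x i)` for every affine piece `a` of `u i`. At each of its points
the allocation `x` is feasible and weakly Pareto dominates `e`. Pareto optimality forces `t = 0`
(`eq_of_weakly_dominates`). Monotonicity under limited resources forces `∑ i, x i = ē`, since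
otherwise some agent could be made strictly better off (`sum_eq_total_of_weakly_dominates`).
Hence the linear functional `-∑ i, t i - ∑ k, (ē k - ∑ i, x i k)` is nonnegative on the polyhedron.
By the Farkas lemma (`exists_nonneg_combination`), applied after homogenizing, it is a nonnegative
combination of the constraints. If `σ k ≥ 0` is the multiplier of the resource constraint of good
`k`, then `p k = 1 + σ k` is the desired price. The slack term of the functional contributes the
`1` that makes every price positive, while its `-t i` term turns a gain in utility over `e i` into
an excess of `⟨p, y⟩` over `⟨p, e i⟩`, so no affordable bundle is preferred to `e i`.
-/

namespace ExchangeEconomy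

/-! ### The Farkas lemma for finitely many linear functionals -/

/-- The Farkas lemma over an arbitrary real vector space: a linear functional that is nonnegative
wherever finitely many others are nonnegative is a nonnegative combination of them. No topology or
finite-dimensionality is needed, as the proof is by induction on the number of functionals. -/
theorem exists_nonneg_combination_finset {V ι : Type*} [AddCommGroup V] [Module ℝ V]
    (s : Finset ι) (f : ι → V →ₗ[ℝ] ℝ) (g : V →ₗ[ℝ] ℝ)
    (h : ∀ v, (∀ i ∈ s, 0 ≤ f i v) → 0 ≤ g v) :
    ∃ c : ι → ℝ, (∀ i, 0 ≤ c i) ∧ ∀ v, g v = ∑ i ∈ s, c i * f i v := by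
  classical
  induction s using Finset.induction_on generalizing f g with
  | empty =>
    refine ⟨0, fun i => le_rfl, fun v => ?_⟩
    have h₁ := h v (by simp)
    have h₂ := h (-v) (by simp)
    rw [map_neg] at h₂
    simp only [Finset.sum_empty]
    linarith
  | insert a t ha ih =>
    by_cases ht : ∀ v, (∀ i ∈ t, 0 ≤ f i v) → 0 ≤ g v
    · obtain ⟨c, hc, hg⟩ := ih f g ht
      refine ⟨Function.update c a 0, fun i => ?_, fun v => ?_⟩
      · by_cases hi : i = a
        · subst hi
          simp
        · simpa [hi] using hc i
      · rw [Finset.sum_insert ha, hg v]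
        simp only [Function.update_self, zero_mul, zero_add]
        refine Finset.sum_congr rfl fun i hi => ?_
        rw [Function.update_of_ne (ne_of_mem_of_not_mem hi ha)]
    · push Not at ht
      obtain ⟨w, hw, hgw⟩ := ht
      have haw : f a w < 0 := by
        by_contra! hn
        refine absurd (h w fun i hi => ?_) (not_le.2 hgw)
        rcases Finset.mem_insert.1 hi with rfl | hi
        exacts [hn, hw i hi]
      -- The vector `w` violates only the constraint `f a`. Projecting along it onto the kernel
      -- of `f a` eliminates that constraint: `v ↦ v - (f a v / f a w) • w`.
      set r : ℝ := -(f a w)⁻¹ with hr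
      have hr0 : 0 < r := neg_pos.2 (inv_lt_zero.2 haw)
      have hraw : r * f a w = -1 := by
        rw [hr, neg_mul, inv_mul_cancel₀ haw.ne]
      obtain ⟨c, hc, hg⟩ := ih (fun i => f i + (r * f i w) • f a) (g + (r * g w) • f a) (by
        intro v hv
        have := h (v + (r * f a v) • w) (by
          intro i hi
          rcases Finset.mem_insert.1 hi with rfl | hi
          · simp only [map_add, map_smul, smul_eq_mul]
            linear_combination -(f i v) * hraw
          · have := hv i hi
            simp only [LinearMap.add_apply, LinearMap.smul_apply, smul_eq_mul] at this
            simp only [map_add, map_smul, smul_eq_mul]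
            linarith)
        simp only [map_add, map_smul, smul_eq_mul] at this
        simp only [LinearMap.add_apply, LinearMap.smul_apply, smul_eq_mul]
        linarith)
      refine ⟨Function.update c a (∑ i ∈ t, c i * (r * f i w) - r * g w), fun i => ?_,
        fun v => ?_⟩
      · by_cases hi : i = a
        · subst hi
          rw [Function.update_self]
          have h₁ : 0 ≤ ∑ j ∈ t, c j * (r * f j w) :=
            Finset.sum_nonneg fun j hj => mul_nonneg (hc j) (mul_nonneg hr0.le (hw j hj))
          nlinarith
        · simpa [hi] using hc i
      · have hv := hg v
        simp only [LinearMap.add_apply, LinearMap.smul_apply, smul_eq_mul, mul_add,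
          Finset.sum_add_distrib] at hv
        have h₁ : ∑ i ∈ t, Function.update c a (∑ i ∈ t, c i * (r * f i w) - r * g w) i * f i v
            = ∑ i ∈ t, c i * f i v := Finset.sum_congr rfl fun i hi => by
          rw [Function.update_of_ne (ne_of_mem_of_not_mem hi ha)]
        have h₂ : ∑ i ∈ t, c i * (r * f i w * f a v)
            = (∑ i ∈ t, c i * (r * f i w)) * f a v := by
          rw [Finset.sum_mul]
          exact Finset.sum_congr rfl fun i _ => by ring
        rw [Finset.sum_insert ha, Function.update_self, h₁, sub_mul]
        linarith

/-- The Farkas lemma with a distinguished block `S` of constraints whose multipliers are recorded,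
while those of the remaining constraints `f` are discarded. -/
theorem exists_nonneg_combination {V ι κ : Type*} [AddCommGroup V] [Module ℝ V] [Fintype ι]
    [Fintype κ] (S : κ → V →ₗ[ℝ] ℝ) (f : ι → V →ₗ[ℝ] ℝ) (g : V →ₗ[ℝ] ℝ)
    (h : ∀ v, (∀ k, 0 ≤ S k v) → (∀ i, 0 ≤ f i v) → 0 ≤ g v) :
    ∃ σ : κ → ℝ, (∀ k, 0 ≤ σ k) ∧ ∀ v, (∀ i, 0 ≤ f i v) → ∑ k, σ k * S k v ≤ g v := by
  obtain ⟨c, hc, hg⟩ := exists_nonneg_combination_finset Finset.univ (Sum.elim S f) g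
    fun v hv => h v (fun k => hv (.inl k) (Finset.mem_univ _))
      (fun i => hv (.inr i) (Finset.mem_univ _))
  refine ⟨fun k => c (.inl k), fun k => hc _, fun v hv => ?_⟩
  rw [hg v, Fintype.sum_sum_type]
  exact le_add_of_nonneg_right (Finset.sum_nonneg fun i _ => mul_nonneg (hc _) (hv i))

/-! ### Allocations that weakly Pareto dominate the endowments -/

section Dominance

variable {n m : ℕ} {e : Fin n → Fin m → ℝ} {u : Fin n → (Fin m → ℝ) → ℝ}

theorem endowment_mem_feasible (he : ∀ i, e i ∈ Bundles m) : e ∈ Feasible e :=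
  ⟨he, fun k => by simp [total]⟩

/-- The infimum in the definition of the utility possibility set is not a junk value: utilities
are bounded below on feasible allocations. -/
theorem IsPLCOn.bddBelow_image_feasible {i : Fin n} (hu : IsPLCOn (Bundles m) (u i)) :
    BddBelow ((fun x : Fin n → Fin m → ℝ => u i (x i)) '' Feasible e) := by
  obtain ⟨K, hK, huK⟩ := hu
  have hcont : Continuous fun y : Fin m → ℝ => K.inf' hK fun a => a y :=
    Continuous.finset_inf'_apply hK fun a _ => a.continuous_of_finiteDimensional
  refine ((isCompact_Icc (a := (0 : Fin m → ℝ)) (b := total e)).bddBelow_image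
    hcont.continuousOn).mono ?_
  rintro _ ⟨x, hx, rfl⟩
  refine ⟨x i, ⟨hx.1 i, fun k => ?_⟩, (huK _ (hx.1 i)).symm⟩
  exact (Finset.single_le_sum (f := fun j => x j k) (fun j _ => hx.1 j k)
    (Finset.mem_univ i)).trans (hx.2 k)

theorem utility_mem_utilityPossibilitySet (hu : ∀ i, IsPLCOn (Bundles m) (u i))
    {x : Fin n → Fin m → ℝ} (hx : x ∈ Feasible e) :
    (fun i => u i (x i)) ∈ utilityPossibilitySet e u :=
  ⟨x, hx, fun i => ⟨csInf_le (hu i).bddBelow_image_feasible ⟨x, hx, rfl⟩, le_rfl⟩⟩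

theorem eq_of_weakly_dominates (hu : ∀ i, IsPLCOn (Bundles m) (u i))
    (hpareto : ParetoOptimal (utilityPossibilitySet e u) fun i => u i (e i))
    {x : Fin n → Fin m → ℝ} (hx : x ∈ Feasible e) (hle : ∀ i, u i (e i) ≤ u i (x i)) (i : Fin n) :
    u i (x i) = u i (e i) := by
  by_contra hne
  exact hpareto.2 ⟨_, utility_mem_utilityPossibilitySet hu hx, hle, fun h => hne (congrFun h i)⟩

theorem sum_eq_total_of_weakly_dominates (hu : ∀ i, IsPLCOn (Bundles m) (u i))
    (hmono : MonotonicUnderLimitedResources e u)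
    (hpareto : ParetoOptimal (utilityPossibilitySet e u) fun i => u i (e i))
    {x : Fin n → Fin m → ℝ} (hx : x ∈ Feasible e) (hle : ∀ i, u i (e i) ≤ u i (x i)) (k : Fin m) :
    ∑ i, x i k = total e k := by
  refine (hx.2 k).eq_of_not_lt fun hlt => ?_
  obtain ⟨j, y, hy, huy, hyk', -, hsum⟩ := hmono k x ⟨hx, hlt⟩
  have hx' : Function.update x j y ∈ Feasible e := by
    refine ⟨fun i => ?_, fun l => ?_⟩
    · by_cases hi : i = j
      · subst hi
        simpa using hy
      · simpa [hi] using hx.1 i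
    · have hrest : ∑ i ∈ Finset.univ.erase j, Function.update x j y i l
          = ∑ i ∈ Finset.univ.erase j, x i l := Finset.sum_congr rfl fun i hi => by
        rw [Function.update_of_ne (Finset.ne_of_mem_erase hi)]
      rw [← Finset.add_sum_erase _ _ (Finset.mem_univ j), hrest, Function.update_self]
      by_cases hl : l = k
      · subst hl
        exact hsum
      · rw [hyk' l hl, Finset.add_sum_erase _ (fun i => x i l) (Finset.mem_univ j)]
        exact hx.2 l
  have hle' : ∀ i, u i (e i) ≤ u i (Function.update x j y i) := by
    intro i
    by_cases hi : i = j
    · subst hi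
      simpa using (hle i).trans huy.le
    · simpa [hi] using hle i
  have := eq_of_weakly_dominates hu hpareto hx' hle' j
  rw [Function.update_self] at this
  exact absurd (hle j) (by linarith)

end Dominance

/-! ### Supporting prices -/

section Prices

variable {n m : ℕ}

/-- The homogenization of an affine function `a`: on the hyperplane `z = 1` it agrees with `a`. -/
theorem linear_add_mul_eq_mul (a : (Fin m → ℝ) →ᵃ[ℝ] ℝ) (x : Fin m → ℝ) {z : ℝ} (hz : z ≠ 0) :
    a.linear x + z * a 0 = z * a (z⁻¹ • x) := by
  have h : a (z⁻¹ • x) = a.linear (z⁻¹ • x) + a 0 := congrFun a.decomp (z⁻¹ • x)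
  rw [h, map_smul, smul_eq_mul]
  field_simp

/-- Points `(x, t, z)` of the homogenized program: a scaled allocation `x`, scaled utility gains
`t` over the endowments, and the homogenizing scalar `z`. -/
abbrev ProgramSpace (n m : ℕ) : Type := (Fin n → Fin m → ℝ) × (Fin n → ℝ) × ℝ

/-- The unused amount `z * ē k - ∑ i, x i k` of good `k`. -/
def slack (e : Fin n → Fin m → ℝ) (k : Fin m) : ProgramSpace n m →ₗ[ℝ] ℝ where
  toFun v := v.2.2 * total e k - ∑ i, v.1 i k
  map_add' v w := by
    simp only [Prod.fst_add, Prod.snd_add, Pi.add_apply, Finset.sum_add_distrib]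
    ring
  map_smul' c v := by
    simp only [Prod.smul_fst, Prod.smul_snd, Pi.smul_apply, smul_eq_mul, RingHom.id_apply,
      ← Finset.mul_sum]
    ring

/-- The homogenization of `a (x i) - b - t i`, for a piece `a` of the utility function of agent
`i` and her reservation utility `b`. -/
def pieceExcess (i : Fin n) (a : (Fin m → ℝ) →ᵃ[ℝ] ℝ) (b : ℝ) : ProgramSpace n m →ₗ[ℝ] ℝ where
  toFun v := a.linear (v.1 i) + v.2.2 * a 0 - v.2.2 * b - v.2.1 i
  map_add' v w := by
    simp only [Prod.fst_add, Prod.snd_add, Pi.add_apply, map_add]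
    ring
  map_smul' c v := by
    simp only [Prod.smul_fst, Prod.smul_snd, Pi.smul_apply, smul_eq_mul, RingHom.id_apply,
      map_smul]
    ring

/-- The objective `-∑ i, t i - ∑ k, slack k`, whose nonnegativity expresses that an allocation
leaves neither utility gains nor unused resources. -/
def waste (e : Fin n → Fin m → ℝ) : ProgramSpace n m →ₗ[ℝ] ℝ where
  toFun v := -∑ i, v.2.1 i - ∑ k, slack e k v
  map_add' v w := by
    simp only [Prod.fst_add, Prod.snd_add, Pi.add_apply, Finset.sum_add_distrib, map_add]
    ring
  map_smul' c v := by
    simp only [Prod.smul_fst, Prod.smul_snd, Pi.smul_apply, smul_eq_mul, RingHom.id_apply,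
      ← Finset.mul_sum, map_smul]
    ring

/-- The constraints of the program other than `0 ≤ slack e k`, indexed by `z`, the coordinates of
`x`, the coordinates of `t`, and the pieces of the utility functions. -/
def programConstraint (e : Fin n → Fin m → ℝ) (u : Fin n → (Fin m → ℝ) → ℝ)
    (K : Fin n → Finset ((Fin m → ℝ) →ᵃ[ℝ] ℝ)) :
    Unit ⊕ (Fin n × Fin m) ⊕ Fin n ⊕ (Σ i, K i) → ProgramSpace n m →ₗ[ℝ] ℝ
  | .inl _ => LinearMap.snd ℝ _ _ ∘ₗ LinearMap.snd ℝ _ _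
  | .inr (.inl ik) => LinearMap.proj ik.2 ∘ₗ LinearMap.proj ik.1 ∘ₗ LinearMap.fst ℝ _ _
  | .inr (.inr (.inl i)) => LinearMap.proj i ∘ₗ LinearMap.fst ℝ _ _ ∘ₗ LinearMap.snd ℝ _ _
  | .inr (.inr (.inr ia)) => pieceExcess ia.1 ia.2 (u ia.1 (e ia.1))

theorem programConstraint_nonneg_iff {e : Fin n → Fin m → ℝ} {u : Fin n → (Fin m → ℝ) → ℝ}
    {K : Fin n → Finset ((Fin m → ℝ) →ᵃ[ℝ] ℝ)} {x : Fin n → Fin m → ℝ} {t : Fin n → ℝ} {z : ℝ} :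
    (∀ c, 0 ≤ programConstraint e u K c (x, t, z)) ↔
      0 ≤ z ∧ (∀ i k, 0 ≤ x i k) ∧ (∀ i, 0 ≤ t i) ∧
        ∀ i, ∀ a ∈ K i, 0 ≤ a.linear (x i) + z * a 0 - z * u i (e i) - t i := by
  simp only [Sum.forall, Prod.forall, Sigma.forall, Subtype.forall]
  exact ⟨fun h => ⟨h.1 (), h.2⟩, fun h => ⟨fun _ => h.1, h.2⟩⟩

/-- The objective is nonnegative on the program. Points with `z = 0` are recession directions of
the original polyhedron; since resources are bounded, these are trivial. -/
theorem waste_nonneg {e : Fin n → Fin m → ℝ} {u : Fin n → (Fin m → ℝ) → ℝ}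
    {K : Fin n → Finset ((Fin m → ℝ) →ᵃ[ℝ] ℝ)} (hK : ∀ i, (K i).Nonempty)
    (huK : ∀ i, ∀ x ∈ Bundles m, u i x = (K i).inf' (hK i) fun a => a x)
    (hmono : MonotonicUnderLimitedResources e u)
    (hpareto : ParetoOptimal (utilityPossibilitySet e u) fun i => u i (e i))
    (v : ProgramSpace n m) (hs : ∀ k, 0 ≤ slack e k v)
    (hv : ∀ c, 0 ≤ programConstraint e u K c v) : 0 ≤ waste e v := by
  obtain ⟨x, t, z⟩ := v
  obtain ⟨hz, hx, ht, ha⟩ := programConstraint_nonneg_iff.1 hv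
  replace hs : ∀ k, 0 ≤ z * total e k - ∑ i, x i k := hs
  suffices (∀ i, t i = 0) ∧ ∀ k, ∑ i, x i k = z * total e k by
    change 0 ≤ -∑ i, t i - ∑ k, (z * total e k - ∑ i, x i k)
    simp [this.1, this.2]
  rcases hz.eq_or_lt with rfl | hz
  · have hx0 : ∀ i k, x i k = 0 := fun i k => by
      refine le_antisymm ((Finset.single_le_sum (f := fun j => x j k) (fun j _ => hx j k)
        (Finset.mem_univ i)).trans ?_) (hx i k)
      linarith [hs k]
    refine ⟨fun i => ?_, fun k => by simp [hx0]⟩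
    obtain ⟨a, haK⟩ := hK i
    have h := ha i a haK
    rw [show x i = 0 from funext (hx0 i), map_zero] at h
    linarith [ht i]
  · have hy : z⁻¹ • x ∈ Feasible e := by
      refine ⟨fun i k => mul_nonneg (inv_nonneg.2 hz.le) (hx i k), fun k => ?_⟩
      simp only [Pi.smul_apply, smul_eq_mul, ← Finset.mul_sum]
      rw [inv_mul_le_iff₀ hz]
      linarith [hs k]
    have hgain : ∀ i, u i (e i) + z⁻¹ * t i ≤ u i ((z⁻¹ • x) i) := by
      intro i
      rw [huK i _ (hy.1 i), Finset.le_inf'_iff]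
      intro a haK
      have h := ha i a haK
      rw [linear_add_mul_eq_mul a _ hz.ne'] at h
      rw [← mul_le_mul_iff_right₀ hz, mul_add, mul_inv_cancel_left₀ hz.ne', Pi.smul_apply]
      linarith
    have hle : ∀ i, u i (e i) ≤ u i ((z⁻¹ • x) i) := fun i =>
      (le_add_of_nonneg_right (mul_nonneg (inv_nonneg.2 hz.le) (ht i))).trans (hgain i)
    have hu : ∀ i, IsPLCOn (Bundles m) (u i) := fun i => ⟨K i, hK i, huK i⟩
    constructor
    · intro i
      have h := hgain i
      rw [eq_of_weakly_dominates hu hpareto hy hle i, add_le_iff_nonpos_right,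
        inv_mul_le_iff₀ hz, mul_zero] at h
      exact le_antisymm h (ht i)
    · intro k
      have h := sum_eq_total_of_weakly_dominates hu hmono hpareto hy hle k
      simp only [Pi.smul_apply, smul_eq_mul, ← Finset.mul_sum] at h
      rw [← h, mul_inv_cancel_left₀ hz.ne']

end Prices

end ExchangeEconomy

theorem theorem5 (n m : ℕ) (e : Fin n → Fin m → ℝ) (u : Fin n → (Fin m → ℝ) → ℝ)
    (he : ∀ i, e i ∈ ExchangeEconomy.Bundles m) (he0 : ∀ i, e i ≠ 0)
    (hu : ∀ i, ExchangeEconomy.IsPLCOn (ExchangeEconomy.Bundles m) (u i))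
    (hmono : ExchangeEconomy.MonotonicUnderLimitedResources e u)
    (hpareto : ExchangeEconomy.ParetoOptimal (ExchangeEconomy.utilityPossibilitySet e u)
      (fun i => u i (e i))) :
    ∃ p : Fin m → ℝ, (∀ k, 0 < p k) ∧ ExchangeEconomy.IsWalrasianEquilibrium e u p e := by
  open ExchangeEconomy in
  choose K hK huK using hu
  obtain ⟨σ, hσ, hdual⟩ := exists_nonneg_combination (slack e) (programConstraint e u K) (waste e)
    (waste_nonneg hK huK hmono hpareto)
  refine ⟨fun k => 1 + σ k, fun k => by linarith [hσ k], rfl, fun i => ⟨⟨he i, le_rfl⟩, ?_⟩⟩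
  rintro y ⟨hy, hbudget⟩
  by_contra! hlt
  -- Evaluate the dual certificate where only agent `i` deviates, to `y`, and `t i` is her gain.
  -- The resource constraints may fail there, but all others hold.
  have hcert := hdual (Function.update e i y, Pi.single i (u i y - u i (e i)), 1) (by
    refine programConstraint_nonneg_iff.2 ⟨zero_le_one, fun j => ?_, fun j => ?_, fun j a ha => ?_⟩
    · by_cases hj : j = i
      · subst hj
        rw [Function.update_self]
        exact hy
      · rw [Function.update_of_ne hj]
        exact he j
    · by_cases hj : j = i
      · subst hj
        simpa using hlt.le
      · simp [hj]
    · rw [linear_add_mul_eq_mul a _ one_ne_zero, inv_one, one_smul]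
      by_cases hj : j = i
      · subst hj
        have := Finset.inf'_le (fun a => a y) ha
        rw [← huK j y hy] at this
        simp only [Function.update_self, Pi.single_eq_same]
        linarith
      · have := Finset.inf'_le (fun a => a (e j)) ha
        rw [← huK j (e j) (he j)] at this
        simp only [Function.update_of_ne hj, Pi.single_eq_of_ne hj]
        linarith)
  have hslack : ∀ k, slack e k (Function.update e i y, Pi.single i (u i y - u i (e i)), 1)
      = e i k - y k := by
    intro k
    change 1 * total e k - ∑ j, Function.update e i y j k = _
    have hrest : ∑ j ∈ Finset.univ.erase i, Function.update e i y j k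
        = ∑ j ∈ Finset.univ.erase i, e j k := Finset.sum_congr rfl fun j hj => by
      rw [Function.update_of_ne (Finset.ne_of_mem_erase hj)]
    rw [total, Finset.sum_apply, ← Finset.add_sum_erase _ _ (Finset.mem_univ i),
      ← Finset.add_sum_erase _ (fun j => Function.update e i y j k) (Finset.mem_univ i), hrest,
      Function.update_self]
    ring
  have hwaste : waste e (Function.update e i y, Pi.single i (u i y - u i (e i)), 1)
      = -(u i y - u i (e i)) - ∑ k, (e i k - y k) := by
    change -∑ j, (Pi.single i (u i y - u i (e i)) : Fin n → ℝ) j - ∑ k, slack e k _ = _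
    rw [Finset.sum_congr rfl fun k _ => hslack k]
    simp
  rw [hwaste, Finset.sum_congr rfl fun k _ => by rw [hslack k]] at hcert
  simp only [dotProduct, add_mul, one_mul, Finset.sum_add_distrib] at hbudget
  simp only [mul_sub, Finset.sum_sub_distrib] at hcert
  linarith
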